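/- All graphs are finite, simple and undirected, and are considered up to isomorphism. **Augmented cubes.** The augmented cube $AQ_n$ ($n\ge 1$) has as vertices the $2^n$ binary strings of length $n$. $AQ_1=K_2$. For $n\ge 2$, two strings $u=u_0u'$ and $v=v_0v'$ with first digits $u_0,v_0$ are adjacent in $AQ_n$ if and only if either $u_0=v_0$ and $u',v'$ are adjacent in $AQ_{n-1}$, or $u_0\ne v_0$ and $u',v'$ agree in every position or differ in every position. Let $\mathcal{GAQ}_4=\{AQ_4\}$. For $n\ge 5$, $\mathcal{GAQ}_n$ consists of all graphs $(V_1\cup V_2,\;E_1\cup E_2\cup M_1\cup M_2)$, where $(V_1,E_1)$ and $(V_2,E_2)$ are (possibly isomorphic) graphs in $\mathcal{GAQ}_{n-1}$ with disjoint vertex sets, and $M_1,M_2$ are edge-disjoint perfect matchings between $V_1$ and $V_2$. **Preclusion.** For a graph $G$ and $F\subseteq V(G)\cup E(G)$, let $G-F$ be the graph obtained by deleting the vertices and edges in $F$, let $|F|$ be the number of elements (vertices and edges) of $F$, and let $\delta(G)$ be the minimum degree of $G$. An almost perfect matching is a matching that covers all vertices but exactly one. A fractional perfect matching of a graph $H$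 is a function $f:E(H)\to[0,1]$ with $\sum_{e\ni v}f(e)=1$ for every vertex $v$ of $H$. * $F$ is a *strong matching preclusion (SMP) set* of $G$ if $G-F$ has neither a perfect matching nor an almost perfect matching; $smp(G)$ is the minimum of $|F|$ over all SMP sets, and an SMP set is *optimal* if $|F|=smp(G)$. $G$ is *even strongly super matched* if $smp(G)=\delta(G)$ and every optimal SMP set $F$ containing an even number of vertices is *trivial*, that is, $G$ has an even number of vertices and $G-F$ has an isolated vertex. * $F$ is a *fractional strong matching preclusion (FSMP) set* of $G$ if $G-F$ has no fractional perfect matching; $fsmp(G)$ is the minimum of $|F|$ over all FSMP sets, and an FSMP set is *optimal* if $|F|=fsmp(G)$. $G$ is *fractional strongly super matched* if $fsmp(G)=\delta(G)$ and $G-F$ has an isolated vertex for every optimal FSMP set $F$. **Theorem 3.5.** Let $n\ge 5$. Suppose that 1. every graph in $\mathcal{GAQ}_{n-1}$ is even strongly super matched, and 2. every graph in $\mathcal{GAQ}_{n-1}$ is fractional strongly super matched. Then every graph in $\mathcal{GAQ}_n$ is fractional strongly super matched. -/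

import Mathlib

universe u

namespace FSMP

/-! ### Augmented cubes and generalized augmented cubes -/

/-- The `n`-dimensional augmented cube, on the binary strings of length `n` (position `0` is the
first digit). It consists of two copies of the `(n-1)`-dimensional one, with the first digit telling
the copies apart, joined by the cross edges (remaining digits all equal) and the complement edges
(remaining digits all different). The definition is meant for `n ≥ 1`; the `0`-dimensional cube is
a single vertex. -/
def augmentedCube : (n : ℕ) → SimpleGraph (Fin n → Bool)
  | 0 => ⊥
  | 1 => ⊤
  | n + 2 =>
    { Adj := fun u v =>
        (u 0 = v 0 ∧ (augmentedCube (n + 1)).Adj (Fin.tail u) (Fin.tail v)) ∨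
        (u 0 ≠ v 0 ∧ ((∀ i, Fin.tail u i = Fin.tail v i) ∨ (∀ i, Fin.tail u i ≠ Fin.tail v i)))
      symm := ⟨by
        rintro u v (⟨h, h'⟩ | ⟨h, h' | h'⟩)
        · exact Or.inl ⟨h.symm, h'.symm⟩
        · exact Or.inr ⟨h.symm, Or.inl fun i => (h' i).symm⟩
        · exact Or.inr ⟨h.symm, Or.inr fun i => (h' i).symm⟩⟩
      loopless := ⟨by
        rintro u (⟨_, h⟩ | ⟨h, _⟩)
        · exact (augmentedCube (n + 1)).irrefl h
        · exact h rfl⟩ }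

/-- The disjoint union of `G₁` and `G₂` together with the edges of two perfect matchings
`{a, M₁ a}` and `{a, M₂ a}` between the two vertex sets. (A perfect matching all of whose edges run
between `V₁` and `V₂` is the same thing as a bijection `V₁ ≃ V₂`.) -/
def glue {V₁ V₂ : Type u} (G₁ : SimpleGraph V₁) (G₂ : SimpleGraph V₂) (M₁ M₂ : V₁ ≃ V₂) :
    SimpleGraph (V₁ ⊕ V₂) where
  Adj
    | Sum.inl a, Sum.inl b => G₁.Adj a b
    | Sum.inr a, Sum.inr b => G₂.Adj a b
    | Sum.inl a, Sum.inr b => b = M₁ a ∨ b = M₂ a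
    | Sum.inr b, Sum.inl a => b = M₁ a ∨ b = M₂ a
  symm := ⟨by
    rintro (a | a) (b | b) h
    · exact G₁.adj_symm h
    · exact h
    · exact h
    · exact G₂.adj_symm h⟩
  loopless := ⟨by
    rintro (a | a) h
    · exact G₁.irrefl h
    · exact G₂.irrefl h⟩

/-- `IsGAQ n G`: the graph `G` is (isomorphic to) a member of the class of `n`-dimensional
generalized augmented cubes. For `n = 4` the only one is the augmented cube; for `n ≥ 5` they are
obtained from two, possibly isomorphic, `(n-1)`-dimensional ones on disjoint vertex sets by adding
two edge-disjoint perfect matchings between the vertex sets. -/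
inductive IsGAQ : ℕ → ∀ {V : Type u}, SimpleGraph V → Prop
  | base {V : Type u} (G : SimpleGraph V) (e : G ≃g augmentedCube 4) : IsGAQ 4 G
  | step {n : ℕ} {V₁ V₂ V : Type u} {G₁ : SimpleGraph V₁} {G₂ : SimpleGraph V₂}
      (h₁ : IsGAQ n G₁) (h₂ : IsGAQ n G₂) (M₁ M₂ : V₁ ≃ V₂) (disj : ∀ a, M₁ a ≠ M₂ a)
      (G : SimpleGraph V) (e : G ≃g glue G₁ G₂ M₁ M₂) : IsGAQ (n + 1) G

/-! ### Perfect, almost perfect and fractional perfect matchings -/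

section Matchings

variable {V : Type u}

/-- The graph has a perfect matching. -/
def HasPerfectMatching (G : SimpleGraph V) : Prop :=
  ∃ M : G.Subgraph, M.IsPerfectMatching

/-- The graph has an almost perfect matching: a matching covering all vertices but exactly one. -/
def HasAlmostPerfectMatching (G : SimpleGraph V) : Prop :=
  ∃ M : G.Subgraph, M.IsMatching ∧ ∃ v : V, M.verts = {v}ᶜ

open Classical in
/-- The graph has a fractional perfect matching: edge weights in `[0, 1]` which at every vertex sum
to `1` over the edges incident to it. (The values of `f` off the edge set play no role.) -/
def HasFractionalPerfectMatching [Fintype V] (G : SimpleGraph V) : Prop :=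
  ∃ f : Sym2 V → ℝ, (∀ e ∈ G.edgeSet, 0 ≤ f e ∧ f e ≤ 1) ∧
    ∀ v : V, ∑ e ∈ G.incidenceFinset v, f e = 1

/-- The graph has an isolated vertex. -/
def HasIsolatedVertex (G : SimpleGraph V) : Prop :=
  ∃ v : V, ∀ w : V, ¬ G.Adj v w

end Matchings

/-! ### Deleting vertices and edges -/

section Deletion

variable {V : Type u}

/-- A finite set `F ⊆ V(G) ∪ E(G)` of vertices and edges of `G`. -/
structure FaultSet (G : SimpleGraph V) where
  /-- the vertices in `F` -/
  verts : Finset V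
  /-- the edges in `F` -/
  edges : Finset (Sym2 V)
  edges_subset : ∀ e ∈ edges, e ∈ G.edgeSet

/-- The number `|F|` of elements of `F`, vertices and edges together. -/
def FaultSet.card {G : SimpleGraph V} (F : FaultSet G) : ℕ :=
  F.verts.card + F.edges.card

/-- The graph `G - F`, on the vertices of `G` that are not in `F`. -/
def FaultSet.delete {G : SimpleGraph V} (F : FaultSet G) : SimpleGraph {v : V // v ∉ F.verts} :=
  (G.deleteEdges (F.edges : Set (Sym2 V))).comap Subtype.val

end Deletion

/-! ### Strong matching preclusion -/

section Strong

variable {V : Type u}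

/-- `F` is a strong matching preclusion set: `G - F` has neither a perfect nor an almost perfect
matching. -/
def IsSMPSet {G : SimpleGraph V} (F : FaultSet G) : Prop :=
  ¬ HasPerfectMatching F.delete ∧ ¬ HasAlmostPerfectMatching F.delete

/-- The strong matching preclusion number `smp(G)`, the least size of a strong matching preclusion
set (`⊤` if there is none). -/
noncomputable def smp (G : SimpleGraph V) : ℕ∞ :=
  ⨅ (F : FaultSet G) (_ : IsSMPSet F), (F.card : ℕ∞)

/-- An optimal strong matching preclusion set. -/
def IsOptimalSMPSet {G : SimpleGraph V} (F : FaultSet G) : Prop :=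
  IsSMPSet F ∧ (F.card : ℕ∞) = smp G

open Classical in
/-- `G` is strongly maximally matched: `smp(G) = δ(G)`. -/
def StronglyMaximallyMatched [Fintype V] (G : SimpleGraph V) : Prop :=
  smp G = G.minDegree

/-- `F` is basic: an optimal strong matching preclusion set such that `G - F` has isolated
vertices. -/
def IsBasicSMPSet {G : SimpleGraph V} (F : FaultSet G) : Prop :=
  IsOptimalSMPSet F ∧ HasIsolatedVertex F.delete

/-- `F` is trivial: it is basic, `G` is even and `F` has an even number of vertices. -/
def IsTrivialSMPSet [Fintype V] {G : SimpleGraph V} (F : FaultSet G) : Prop :=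
  IsBasicSMPSet F ∧ Even (Fintype.card V) ∧ Even F.verts.card

/-- `G` is even strongly super matched: it is strongly maximally matched, and every optimal strong
matching preclusion set with an even number of vertices is trivial. -/
def EvenStronglySuperMatched [Fintype V] (G : SimpleGraph V) : Prop :=
  StronglyMaximallyMatched G ∧
    ∀ F : FaultSet G, IsOptimalSMPSet F → Even F.verts.card → IsTrivialSMPSet F

end Strong

/-! ### Fractional strong matching preclusion -/

section Fractional

variable {V : Type u} [Fintype V]

open Classical in
/-- `F` is a fractional strong matching preclusion set: `G - F` has no fractional perfect
matching. -/
def IsFSMPSet {G : SimpleGraph V} (F : FaultSet G) : Prop :=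
  ¬ HasFractionalPerfectMatching F.delete

/-- The fractional strong matching preclusion number `fsmp(G)`, the least size of a fractional
strong matching preclusion set (`⊤` if there is none). -/
noncomputable def fsmp (G : SimpleGraph V) : ℕ∞ :=
  ⨅ (F : FaultSet G) (_ : IsFSMPSet F), (F.card : ℕ∞)

/-- An optimal fractional strong matching preclusion set. -/
def IsOptimalFSMPSet {G : SimpleGraph V} (F : FaultSet G) : Prop :=
  IsFSMPSet F ∧ (F.card : ℕ∞) = fsmp G

open Classical in
/-- `G` is fractional strongly maximally matched: `fsmp(G) = δ(G)`. -/
def FractionalStronglyMaximallyMatched (G : SimpleGraph V) : Prop :=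
  fsmp G = G.minDegree

/-- `G` is fractional strongly super matched: it is fractional strongly maximally matched, and
`G - F` has an isolated vertex for every optimal fractional strong matching preclusion set `F`. -/
def FractionalStronglySuperMatched (G : SimpleGraph V) : Prop :=
  FractionalStronglyMaximallyMatched G ∧
    ∀ F : FaultSet G, IsOptimalFSMPSet F → HasIsolatedVertex F.delete

end Fractional

end FSMP

/-!
A graph has a fractional perfect matching exactly when its bipartite double cover satisfies Hall's
condition, i.e. no vertex set `A` has fewer than `#A` neighbours
(`hasFractionalPerfectMatching_iff`). For a nonempty `d`-regular graph, being fractional strongly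
super matched therefore means: deleting at most `d` vertices and edges either leaves an isolated
vertex or preserves Hall's condition (`IsRobust`). The theorem reduces to the fact that two
robust graphs of degree `d ≥ 7` joined by two disjoint perfect matchings form a robust graph of
degree `d + 2` (`IsGlued.isRobust`).

Suppose that after at most `d + 2` deletions an independent set `A` has fewer than `#A` neighbours
and that no vertex is isolated. One part, say the first, must have received at least `d` deletions,
which leaves at most two for everything else. In a robust graph each deletion beyond `d - 1` costs a
set at most two neighbours (`IsRobust.card_le_add`), whereas in the nearly undamaged second part a
nonempty independent set has a surplus of neighbours (`IsRobust.card_add_le_card_liveNbrs`), too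
large to be compensated by the first part; so `A` lies in the first part. Each of the two matchings
sends `A` injectively to its neighbours in the second part, up to deletions, so `A` has at most one
neighbour in the first part.

If it has none, `A` consists of vertices isolated in the first part. There, at most `d + 1`
deletions took place, which isolate at most one vertex (`IsRobust.eq_of_liveNbrs_eq_empty`), and that
one has a neighbour in the second part. If it has one, exactly `d` deletions took place in the first
part and they isolate a vertex `v`, so all of them are spent around `v`; two vertices of `A` other
than `v` then keep at least two neighbours in the first part
(`IsRobust.two_le_card_liveNbrs_pair`), a contradiction. Both facts rest on the
expansion of pairs of vertices (`IsRobust.add_two_le_card_union`,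
`IsRobust.add_one_le_card_union_sdiff`).
-/

namespace FSMP

/-! ### Fractional perfect matchings and Hall's condition -/

section Hall

open Classical Finset

variable {V : Type u}

lemma FaultSet.delete_adj {G : SimpleGraph V} (F : FaultSet G) (x y : {v : V // v ∉ F.verts}) :
    F.delete.Adj x y ↔ G.Adj x y ∧ s((x : V), (y : V)) ∉ F.edges := by
  simp [FaultSet.delete, SimpleGraph.deleteEdges_adj]

variable [Fintype V]

lemma sum_incidenceFinset (G : SimpleGraph V) (f : Sym2 V → ℝ) (v : V) :
    ∑ e ∈ G.incidenceFinset v, f e = ∑ w, if G.Adj v w then f s(v, w) else 0 := by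
  have h : G.incidenceFinset v = (univ.filter (G.Adj v)).image fun w => s(v, w) := by
    ext e
    induction e with | _ a b
    simp only [SimpleGraph.mem_incidenceFinset, SimpleGraph.mk'_mem_incidenceSet_iff, mem_image,
      mem_filter, mem_univ, true_and]
    constructor
    · rintro ⟨h, rfl | rfl⟩
      · exact ⟨b, h, rfl⟩
      · exact ⟨a, h.symm, Sym2.eq_swap⟩
    · rintro ⟨w, hw, h⟩
      rcases Sym2.eq_iff.1 h with ⟨rfl, rfl⟩ | ⟨rfl, rfl⟩
      · exact ⟨hw, Or.inl rfl⟩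
      · exact ⟨hw.symm, Or.inr rfl⟩
  rw [h, sum_image (fun x _ y _ hxy => Sym2.congr_right.1 hxy), sum_filter]

/-- Hall's condition for the bipartite double cover: a fractional perfect matching exists exactly
when no vertex set has fewer neighbours than elements. -/
theorem hasFractionalPerfectMatching_iff (G : SimpleGraph V) :
    HasFractionalPerfectMatching G ↔
      ∀ A : Finset V, #A ≤ #(univ.filter fun y => ∃ x ∈ A, G.Adj x y) := by
  constructor
  · rintro ⟨f, hf, hsum⟩ A
    replace hsum : ∀ v, ∑ w, (if G.Adj v w then f s(v, w) else 0) = 1 := fun v => by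
      rw [← sum_incidenceFinset]
      convert hsum v
    have hnn : ∀ v w, 0 ≤ if G.Adj v w then f s(v, w) else 0 := fun v w => by
      split_ifs with h
      · exact (hf _ h).1
      · exact le_rfl
    have key : (#A : ℝ) ≤ #(univ.filter fun y => ∃ x ∈ A, G.Adj x y) := calc
      (#A : ℝ) = ∑ v ∈ A, ∑ w, (if G.Adj v w then f s(v, w) else 0) := by simp [hsum]
      _ = ∑ v ∈ A, ∑ w ∈ univ.filter fun y => ∃ x ∈ A, G.Adj x y,
            (if G.Adj v w then f s(v, w) else 0) := by
          refine sum_congr rfl fun v hv => (sum_subset (subset_univ _) fun w _ hw => ?_).symm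
          rw [if_neg]
          intro h
          exact hw (mem_filter.2 ⟨mem_univ _, v, hv, h⟩)
      _ = ∑ w ∈ univ.filter fun y => ∃ x ∈ A, G.Adj x y, ∑ v ∈ A,
            (if G.Adj v w then f s(v, w) else 0) := sum_comm
      _ ≤ ∑ w ∈ univ.filter fun y => ∃ x ∈ A, G.Adj x y, ∑ v,
            (if G.Adj v w then f s(v, w) else 0) :=
          sum_le_sum fun w _ => sum_le_sum_of_subset_of_nonneg (subset_univ _) fun v _ _ => hnn v w
      _ = ∑ w ∈ univ.filter fun y => ∃ x ∈ A, G.Adj x y, (1 : ℝ) := by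
          refine sum_congr rfl fun w _ => ?_
          rw [← hsum w]
          refine sum_congr rfl fun v _ => ?_
          rw [G.adj_comm, Sym2.eq_swap]
      _ = _ := by simp
    exact_mod_cast key
  · intro h
    obtain ⟨σ, hinj, hσ⟩ := (all_card_le_biUnion_card_iff_exists_injective
      (fun x : V => univ.filter (G.Adj x))).1 fun A => by
        refine (h A).trans (card_le_card fun y hy => ?_)
        simpa using hy
    have hadj : ∀ x, G.Adj x (σ x) := fun x => by simpa using hσ x
    have hbij : Function.Bijective σ := Finite.injective_iff_bijective.1 hinj
    -- every arc `x → σ x` of the permutation contributes weight `1/2` to its edge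
    set f : Sym2 V → ℝ := fun e => ∑ x, if s(x, σ x) = e then 1 / 2 else 0 with hfdef
    have hnn : ∀ e, 0 ≤ f e := fun e => sum_nonneg fun x _ => by positivity
    have hsum : ∀ v, ∑ e ∈ G.incidenceFinset v, f e = 1 := by
      intro v
      rw [hfdef, sum_comm]
      have h1 : ∀ x, (∑ e ∈ G.incidenceFinset v, if s(x, σ x) = e then (1 / 2 : ℝ) else 0) =
          (if x = v then 1 / 2 else 0) + (if σ x = v then 1 / 2 else 0) := by
        intro x
        rw [sum_ite_eq]
        have hne := (hadj x).ne
        simp only [SimpleGraph.mem_incidenceFinset, SimpleGraph.mk'_mem_incidenceSet_iff, hadj x,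
          true_and]
        by_cases h1 : x = v <;> by_cases h2 : σ x = v
        · exact absurd (h1.trans h2.symm) hne
        all_goals simp [h1, h2, eq_comm]
        all_goals simp_all [eq_comm]
      obtain ⟨w, hw⟩ := hbij.2 v
      have h2 : ∀ x, σ x = v ↔ x = w := fun x => by rw [← hw, hinj.eq_iff]
      simp only [h1, sum_add_distrib, h2, sum_ite_eq', mem_univ, if_true]
      norm_num
    refine ⟨f, fun e he => ⟨hnn e, ?_⟩, fun v => by convert hsum v⟩
    induction e with | _ a b
    rw [← hsum a]
    exact single_le_sum (fun e _ => hnn e)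
      (by simpa [SimpleGraph.mk'_mem_incidenceSet_iff] using he)

/-- The vertices outside `X` that are joined to a vertex of `A` by an edge not in `E`. For `A`
disjoint from `X` these are the neighbours of `A` after the deletion of `X` and `E`; the elements of
`E` are not required to be edges. -/
noncomputable def liveNbrs (G : SimpleGraph V) (X : Finset V) (E : Finset (Sym2 V))
    (A : Finset V) : Finset V :=
  univ.filter fun y => y ∉ X ∧ ∃ x ∈ A, G.Adj x y ∧ s(x, y) ∉ E

@[simp]
lemma mem_liveNbrs {G : SimpleGraph V} {X : Finset V} {E : Finset (Sym2 V)} {A : Finset V} {y : V} :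
    y ∈ liveNbrs G X E A ↔ y ∉ X ∧ ∃ x ∈ A, G.Adj x y ∧ s(x, y) ∉ E := by
  simp [liveNbrs]

lemma FaultSet.hasFractionalPerfectMatching_delete_iff {G : SimpleGraph V} (F : FaultSet G) :
    HasFractionalPerfectMatching F.delete ↔
      ∀ A : Finset V, Disjoint A F.verts → #A ≤ #(liveNbrs G F.verts F.edges A) := by
  rw [hasFractionalPerfectMatching_iff]
  have key : ∀ A : Finset {v : V // v ∉ F.verts},
      (univ.filter fun y => ∃ x ∈ A, F.delete.Adj x y).map (Function.Embedding.subtype _) =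
        liveNbrs G F.verts F.edges (A.map (Function.Embedding.subtype _)) := by
    intro A
    ext y
    simp [FaultSet.delete_adj, and_comm]
  constructor
  · intro h A hA
    have h1 := h (A.subtype _)
    rw [← card_map (Function.Embedding.subtype _), ← card_map (Function.Embedding.subtype _),
      key, subtype_map_of_mem (fun x hx => disjoint_left.1 hA hx)] at h1
    exact h1
  · intro h A
    rw [← card_map (Function.Embedding.subtype _), ← card_map (Function.Embedding.subtype _), key]
    refine h _ (disjoint_left.2 fun x hx => ?_)
    obtain ⟨y, -, rfl⟩ := mem_map.1 hx
    exact y.2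

lemma FaultSet.hasIsolatedVertex_delete_iff {G : SimpleGraph V} (F : FaultSet G) :
    HasIsolatedVertex F.delete ↔ ∃ v ∉ F.verts, liveNbrs G F.verts F.edges {v} = ∅ := by
  simp only [HasIsolatedVertex, FaultSet.delete_adj, Finset.eq_empty_iff_forall_notMem,
    mem_liveNbrs, mem_singleton, exists_eq_left, Subtype.forall, Subtype.exists, exists_prop,
    not_and]

end Hall

/-! ### Robust regular graphs -/

section Robust

open Classical Finset

variable {V : Type u} [Fintype V] {G : SimpleGraph V} {X : Finset V} {E : Finset (Sym2 V)}
  {A : Finset V} {d : ℕ}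

/-- `G` is `d`-regular, and whenever at most `d` vertices and edges are deleted without leaving an
isolated vertex, the remaining graph satisfies Hall's condition. -/
structure IsRobust (G : SimpleGraph V) (d : ℕ) : Prop where
  degree_eq : ∀ v, #(univ.filter (G.Adj v)) = d
  card_le : ∀ (X : Finset V) (E : Finset (Sym2 V)), #X + #E ≤ d →
    (∀ v ∉ X, (liveNbrs G X E {v}).Nonempty) →
    ∀ A, Disjoint A X → #A ≤ #(liveNbrs G X E A)

lemma liveNbrs_mono {A B : Finset V} (h : A ⊆ B) : liveNbrs G X E A ⊆ liveNbrs G X E B := by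
  intro y hy
  rw [mem_liveNbrs] at hy ⊢
  obtain ⟨hy, x, hx, hxy⟩ := hy
  exact ⟨hy, x, h hx, hxy⟩

/-- Around an isolated vertex every neighbour is deleted or its edge is. -/
lemma card_filter_adj_le_of_liveNbrs_eq_empty {v : V} (h : liveNbrs G X E {v} = ∅) :
    #(univ.filter (G.Adj v)) ≤ #((univ.filter (G.Adj v)) ∩ X) + #(E.filter (v ∈ ·)) := by
  rw [← card_inter_add_card_sdiff (univ.filter (G.Adj v)) X]
  refine Nat.add_le_add_left (card_le_card_of_injOn (fun y => s(v, y)) ?_ ?_) _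
  · intro y hy
    simp only [coe_sdiff, Set.mem_sdiff, mem_coe, mem_filter, mem_univ, true_and] at hy
    simp only [coe_filter, Set.mem_ofPred_eq, Sym2.mem_iff, true_or, and_true]
    by_contra hE
    have : y ∈ liveNbrs G X E {v} := by simp [hy.1, hy.2, hE]
    simp [h] at this
  · intro y _ z _ hyz
    exact Sym2.congr_right.1 hyz

/-- From a set `A` violating Hall's condition an independent one is obtained by removing the
neighbours of `A`: the vertices removed are not neighbours of those that remain. -/
lemma exists_independent_of_card_liveNbrs_lt (hA : Disjoint A X)
    (h : #(liveNbrs G X E A) < #A) :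
    ∃ I, Disjoint I X ∧ Disjoint I (liveNbrs G X E I) ∧ #(liveNbrs G X E I) < #I := by
  have hsymm : ∀ x y, G.Adj x y ∧ s(x, y) ∉ E → G.Adj y x ∧ s(y, x) ∉ E := fun x y h =>
    ⟨h.1.symm, by rw [Sym2.eq_swap]; exact h.2⟩
  have hsub : liveNbrs G X E (A \ liveNbrs G X E A) ⊆ liveNbrs G X E A \ A := by
    intro y hy
    refine mem_sdiff.2 ⟨liveNbrs_mono sdiff_subset hy, fun hyA => ?_⟩
    obtain ⟨hyX, x, hx, hxy⟩ := mem_liveNbrs.1 hy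
    rw [mem_sdiff] at hx
    exact hx.2 (mem_liveNbrs.2 ⟨disjoint_left.1 hA hx.1, y, hyA, hsymm _ _ hxy⟩)
  refine ⟨A \ liveNbrs G X E A, hA.mono_left sdiff_subset, ?_, ?_⟩
  · exact disjoint_left.2 fun y hy hy' => (mem_sdiff.1 (hsub hy')).2 (mem_sdiff.1 hy).1
  · refine (card_le_card hsub).trans_lt ?_
    have h1 := card_inter_add_card_sdiff A (liveNbrs G X E A)
    have h2 := card_inter_add_card_sdiff (liveNbrs G X E A) A
    rw [inter_comm] at h2
    omega

namespace IsRobust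

lemma nonempty_liveNbrs (hG : IsRobust G d) (h : #X + #E < d) (v : V) :
    (liveNbrs G X E {v}).Nonempty := by
  by_contra hv
  have h1 := card_filter_adj_le_of_liveNbrs_eq_empty (not_nonempty_iff_eq_empty.1 hv)
  rw [hG.degree_eq] at h1
  have h2 := card_le_card (inter_subset_right : univ.filter (G.Adj v) ∩ X ⊆ X)
  have h3 := card_filter_le E (v ∈ ·)
  omega

lemma card_le_of_lt (hG : IsRobust G d) (h : #X + #E < d) (hA : Disjoint A X) :
    #A ≤ #(liveNbrs G X E A) :=
  hG.card_le X E h.le (fun v _ => hG.nonempty_liveNbrs h v) A hA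

/-- Restoring a deleted element changes the deficiency of a set by at most two. -/
lemma card_le_add (hG : IsRobust G d) (hd : 0 < d) (t : ℕ) :
    ∀ {X : Finset V} {E : Finset (Sym2 V)}, #X + #E < d + t → Disjoint A X →
      #A ≤ #(liveNbrs G X E A) + 2 * t := by
  induction t with
  | zero => exact fun h hA => hG.card_le_of_lt h hA
  | succ t ih =>
    intro X E h hA
    rcases E.eq_empty_or_nonempty with rfl | ⟨e, he⟩
    · rcases X.eq_empty_or_nonempty with rfl | ⟨x, hx⟩
      · exact (ih (X := ∅) (E := ∅) (by simp; omega) hA).trans (by omega)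
      · have h1 := ih (X := X.erase x) (E := ∅) (by
          have := card_erase_add_one hx
          omega) (hA.mono_right (erase_subset _ _))
        have h2 : liveNbrs G (X.erase x) ∅ A ⊆ insert x (liveNbrs G X ∅ A) := by
          intro y hy
          rw [mem_insert, mem_liveNbrs]
          rw [mem_liveNbrs, mem_erase] at hy
          by_cases hyx : y = x
          · exact Or.inl hyx
          · exact Or.inr ⟨fun h => hy.1 ⟨hyx, h⟩, hy.2⟩
        have h3 := (card_le_card h2).trans (card_insert_le _ _)
        omega
    · have h1 := ih (X := X) (E := E.erase e) (by
        have := card_erase_add_one he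
        omega) hA
      have h2 : liveNbrs G X (E.erase e) A ⊆ liveNbrs G X E A ∪ e.toFinset := by
        intro y hy
        rw [mem_union, mem_liveNbrs, Sym2.mem_toFinset]
        rw [mem_liveNbrs] at hy
        obtain ⟨hyX, x, hx, hxy, hE⟩ := hy
        by_cases hxe : s(x, y) = e
        · exact Or.inr (hxe ▸ Sym2.mem_mk_right x y)
        · exact Or.inl ⟨hyX, x, hx, hxy, fun h => hE (mem_erase.2 ⟨hxe, h⟩)⟩
      have h3 := (card_le_card h2).trans (card_union_le _ _)
      have h4 : #e.toFinset ≤ 2 := by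
        rw [Sym2.card_toFinset]
        split_ifs <;> omega
      omega

/-- A nonempty independent set has a large surplus of neighbours when few elements are deleted:
otherwise deleting some of its neighbours as well would violate Hall's condition. -/
lemma card_add_le_card_liveNbrs (hG : IsRobust G d) (h : #X + #E < d) (hA : Disjoint A X)
    (hind : Disjoint A (liveNbrs G X E A)) (hne : A.Nonempty) :
    #A + d ≤ #(liveNbrs G X E A) + (#X + #E) + 1 := by
  obtain ⟨Y, hY, hYc⟩ := exists_subset_card_eq
    (min_le_left #(liveNbrs G X E A) (d - 1 - (#X + #E)))
  have hsub : liveNbrs G (X ∪ Y) E A ⊆ liveNbrs G X E A \ Y := by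
    intro y hy
    rw [mem_liveNbrs, mem_union, not_or] at hy
    exact mem_sdiff.2 ⟨mem_liveNbrs.2 ⟨hy.1.1, hy.2⟩, hy.1.2⟩
  have h1 : #A ≤ #(liveNbrs G (X ∪ Y) E A) := by
    refine hG.card_le_of_lt ?_ (disjoint_union_right.2 ⟨hA, hind.mono_right hY⟩)
    have := card_union_le X Y
    omega
  have h2 := card_le_card hsub
  rw [card_sdiff_of_subset hY] at h2
  have h3 := hne.card_pos
  omega

/-- Two nonadjacent vertices of a robust graph have at least `d + 2` neighbours: otherwise deleting
all of these but a common one would have to isolate a third vertex, and the three vertices would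
violate `card_add_le_card_liveNbrs`. -/
lemma add_two_le_card_union (hG : IsRobust G d) (hd : 3 ≤ d) {u v : V} (huv : u ≠ v)
    (hadj : ¬ G.Adj u v) :
    d + 2 ≤ #(univ.filter (G.Adj u) ∪ univ.filter (G.Adj v)) := by
  set T := univ.filter (G.Adj u) ∪ univ.filter (G.Adj v) with hT
  have hmT : ∀ y, y ∈ T ↔ G.Adj u y ∨ G.Adj v y := fun y => by simp [hT]
  have huT : u ∉ T := fun h => by
    rcases (hmT u).1 h with h | h
    · exact G.irrefl h
    · exact hadj h.symm
  have hvT : v ∉ T := fun h => by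
    rcases (hmT v).1 h with h | h
    · exact hadj h
    · exact G.irrefl h
  by_contra! hlt
  have hint := card_union_add_card_inter (univ.filter (G.Adj u)) (univ.filter (G.Adj v))
  rw [hG.degree_eq, hG.degree_eq, ← hT] at hint
  obtain ⟨x, hx⟩ : (univ.filter (G.Adj u) ∩ univ.filter (G.Adj v)).Nonempty := by
    rw [← card_pos]; omega
  simp only [mem_inter, mem_filter, mem_univ, true_and] at hx
  have hxT : x ∈ T := (hmT x).2 (Or.inl hx.1)
  have hTx := card_erase_add_one hxT
  -- deleting all neighbours but the common neighbour `x` violates Hall's condition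
  have hnot : ¬ ∀ w ∉ T.erase x, (liveNbrs G (T.erase x) ∅ {w}).Nonempty := by
    intro hw
    have h1 := hG.card_le (T.erase x) ∅ (by simp; omega) hw {u, v} (by
      rw [disjoint_left]
      intro y hy hy'
      have := mem_of_mem_erase hy'
      rcases mem_insert.1 hy with rfl | hy
      · exact huT this
      · rw [mem_singleton.1 hy] at this
        exact hvT this)
    have h2 : liveNbrs G (T.erase x) ∅ {u, v} ⊆ {x} := by
      intro y hy
      simp only [mem_liveNbrs, mem_erase, hmT] at hy
      rw [mem_singleton]
      by_contra hne
      refine hy.1 ⟨hne, ?_⟩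
      simpa using hy.2
    have h3 := card_le_card h2
    rw [card_pair huv] at h1
    rw [card_singleton] at h3
    omega
  push Not at hnot
  obtain ⟨w, hw, hwe⟩ := hnot
  have hwT : ∀ y, G.Adj w y → y ∈ T.erase x := by
    intro y hy
    by_contra hyT
    have : y ∈ liveNbrs G (T.erase x) ∅ {w} := by
      rw [mem_liveNbrs]
      exact ⟨hyT, w, mem_singleton_self w, hy, notMem_empty _⟩
    rw [hwe] at this
    exact notMem_empty _ this
  have hwu : w ≠ u := by
    rintro rfl
    exact notMem_erase _ _ (hwT x hx.1)
  have hwv : w ≠ v := by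
    rintro rfl
    exact notMem_erase _ _ (hwT x hx.2)
  have hwnT : w ∉ T := fun h => by
    rcases (hmT w).1 h with h | h
    · exact huT (mem_of_mem_erase (hwT u h.symm))
    · exact hvT (mem_of_mem_erase (hwT v h.symm))
  -- so all neighbours of `w` are neighbours of `u` or `v`, and the independent set `{u, v, w}` has
  -- too few neighbours
  have hsub : liveNbrs G ∅ ∅ {u, v, w} ⊆ T := by
    intro y hy
    rw [mem_liveNbrs] at hy
    obtain ⟨-, z, hz, hzy, -⟩ := hy
    simp only [mem_insert, mem_singleton] at hz
    rcases hz with rfl | rfl | rfl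
    · exact (hmT y).2 (Or.inl hzy)
    · exact (hmT y).2 (Or.inr hzy)
    · exact mem_of_mem_erase (hwT y hzy)
  have h1 := hG.card_add_le_card_liveNbrs (X := ∅) (E := ∅) (A := {u, v, w})
    (by simp; omega) (disjoint_empty_right _) (by
      rw [disjoint_left]
      intro y hy hy'
      have := hsub hy'
      simp only [mem_insert, mem_singleton] at hy
      rcases hy with rfl | rfl | rfl
      · exact huT this
      · exact hvT this
      · exact hwnT this) ⟨u, by simp⟩
  have h2 := card_le_card hsub
  have h3 : #({u, v, w} : Finset V) = 3 := card_eq_three.2 ⟨u, v, w, huv, hwu.symm, hwv.symm, rfl⟩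
  simp only [h3, card_empty] at h1
  omega

/-- Two adjacent vertices of a robust graph have at least `d + 1` further neighbours: otherwise they
have a common neighbour `x`, and deleting their edge and all their other neighbours would have to
isolate a third vertex, although fewer than `d` vertices are deleted. -/
lemma add_one_le_card_union_sdiff (hG : IsRobust G d) (hd : 3 ≤ d) {u v : V} (hadj : G.Adj u v) :
    d + 1 ≤ #((univ.filter (G.Adj u) ∪ univ.filter (G.Adj v)) \ {u, v}) := by
  set T := (univ.filter (G.Adj u) ∪ univ.filter (G.Adj v)) \ {u, v} with hT
  have hmT : ∀ y, y ∈ T ↔ (G.Adj u y ∨ G.Adj v y) ∧ y ≠ u ∧ y ≠ v := fun y => by simp [hT]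
  have huv : u ≠ v := hadj.ne
  by_contra! hlt
  have hcard : #T = #(univ.filter (G.Adj u) ∪ univ.filter (G.Adj v)) - 2 := by
    rw [hT, card_sdiff_of_subset, card_pair huv]
    intro y hy
    rcases mem_insert.1 hy with rfl | hy
    · simp [hadj.symm]
    · rw [mem_singleton.1 hy]; simp [hadj]
  have hint := card_union_add_card_inter (univ.filter (G.Adj u)) (univ.filter (G.Adj v))
  rw [hG.degree_eq, hG.degree_eq] at hint
  obtain ⟨x, hx⟩ : (univ.filter (G.Adj u) ∩ univ.filter (G.Adj v)).Nonempty := by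
    rw [← card_pos]; omega
  simp only [mem_inter, mem_filter, mem_univ, true_and] at hx
  have hxT : x ∈ T := (hmT x).2 ⟨Or.inl hx.1, hx.1.ne', hx.2.ne'⟩
  have hTx := card_erase_add_one hxT
  -- deleting `uv` and all other neighbours but the common neighbour `x` violates Hall's condition
  have hnot : ¬ ∀ w ∉ T.erase x, (liveNbrs G (T.erase x) {s(u, v)} {w}).Nonempty := by
    intro hw
    have h1 := hG.card_le (T.erase x) {s(u, v)} (by simp; omega) hw {u, v} (by
      rw [disjoint_left]
      intro y hy hy'
      have := (hmT y).1 (mem_of_mem_erase hy')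
      rcases mem_insert.1 hy with rfl | hy
      · exact this.2.1 rfl
      · exact this.2.2 (mem_singleton.1 hy))
    have h2 : liveNbrs G (T.erase x) {s(u, v)} {u, v} ⊆ {x} := by
      intro y hy
      simp only [mem_liveNbrs, mem_erase, hmT, mem_insert, mem_singleton] at hy
      rw [mem_singleton]
      by_contra hne
      obtain ⟨hyT, z, hz, hzy, hE⟩ := hy
      rcases hz with rfl | rfl
      · exact hyT ⟨hne, Or.inl hzy, hzy.ne', fun h => hE (by rw [h])⟩
      · exact hyT ⟨hne, Or.inr hzy, fun h => hE (by rw [h, Sym2.eq_swap]), hzy.ne'⟩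
    have h3 := card_le_card h2
    rw [card_pair huv] at h1
    rw [card_singleton] at h3
    omega
  push Not at hnot
  obtain ⟨w, hw, hwe⟩ := hnot
  have hlive : ∀ y, G.Adj w y → s(w, y) ≠ s(u, v) → y ∈ T.erase x := by
    intro y hy hne
    by_contra hyT
    have : y ∈ liveNbrs G (T.erase x) {s(u, v)} {w} := by
      rw [mem_liveNbrs]
      exact ⟨hyT, w, mem_singleton_self w, hy, by simpa using hne⟩
    rw [hwe] at this
    exact notMem_empty _ this
  have hwu : w ≠ u := by
    rintro rfl
    refine notMem_erase _ _ (hlive x hx.1 fun h => ?_)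
    exact hx.2.ne (Sym2.congr_right.1 h).symm
  have hwv : w ≠ v := by
    rintro rfl
    refine notMem_erase _ _ (hlive x hx.2 fun h => ?_)
    exact hx.1.ne (Sym2.congr_right.1 (h.trans Sym2.eq_swap)).symm
  have hsub : univ.filter (G.Adj w) ⊆ T.erase x := by
    intro y hy
    refine hlive y (by simpa using hy) fun h => ?_
    have : w ∈ s(u, v) := h ▸ Sym2.mem_mk_left w y
    rcases Sym2.mem_iff.1 this with h | h
    · exact hwu h
    · exact hwv h
  have h1 := card_le_card hsub
  rw [hG.degree_eq] at h1
  omega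

/-- Deleting at most `d + 1` elements isolates at most one vertex. -/
lemma eq_of_liveNbrs_eq_empty (hG : IsRobust G d) (hd : 3 ≤ d) (h : #X + #E ≤ d + 1) {u v : V}
    (hu : liveNbrs G X E {u} = ∅) (hv : liveNbrs G X E {v} = ∅) (huX : u ∉ X) (hvX : v ∉ X) :
    u = v := by
  by_contra huv
  have hdead : ∀ {z y}, liveNbrs G X E {z} = ∅ → G.Adj z y → y ∉ X → s(z, y) ∈ E := by
    intro z y hz hzy hy
    by_contra hE
    have : y ∈ liveNbrs G X E {z} := by simp [hzy, hy, hE]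
    simp [hz] at this
  set T := (univ.filter (G.Adj u) ∪ univ.filter (G.Adj v)) \ {u, v} with hT
  have hmT : ∀ y, y ∈ T ↔ (G.Adj u y ∨ G.Adj v y) ∧ y ≠ u ∧ y ≠ v := fun y => by simp [hT]
  -- each vertex of `T` is deleted itself or accounts for a deleted edge to `u` or `v` of its own
  have hcharge : #T ≤ #X + #(E.erase s(u, v)) := by
    rw [← card_inter_add_card_sdiff T X]
    refine Nat.add_le_add (card_le_card inter_subset_right)
      (card_le_card_of_injOn (fun y => if G.Adj u y then s(u, y) else s(v, y)) ?_ ?_)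
    · intro y hy
      simp only [coe_sdiff, Set.mem_sdiff, mem_coe, hmT] at hy
      obtain ⟨⟨hy, hyu, hyv⟩, hyX⟩ := hy
      simp only [coe_erase, Set.mem_sdiff, mem_coe, Set.mem_singleton_iff]
      split_ifs with h1
      · exact ⟨hdead hu h1 hyX, fun h => hyv (Sym2.congr_right.1 h)⟩
      · refine ⟨hdead hv (hy.resolve_left h1) hyX, fun h => hyu ?_⟩
        exact Sym2.congr_right.1 (h.trans Sym2.eq_swap)
    · intro y hy z hz hyz
      simp only [coe_sdiff, Set.mem_sdiff, mem_coe, hmT] at hy hz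
      have : y ∈ (if G.Adj u z then s(u, z) else s(v, z)) := by
        refine Eq.subst (motive := (y ∈ ·)) hyz ?_
        dsimp only
        split_ifs <;> exact Sym2.mem_mk_right _ _
      split_ifs at this
      · exact (Sym2.mem_iff.1 this).resolve_left hy.1.2.1
      · exact (Sym2.mem_iff.1 this).resolve_left hy.1.2.2
  by_cases hadj : G.Adj u v
  · have h1 := hG.add_one_le_card_union_sdiff hd hadj
    have h2 := card_erase_add_one (hdead hu hadj hvX)
    rw [← hT] at h1
    omega
  · have h1 := hG.add_two_le_card_union hd huv hadj
    have h2 : T = univ.filter (G.Adj u) ∪ univ.filter (G.Adj v) := by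
      refine sdiff_eq_self_of_disjoint (disjoint_left.2 fun y hy hy' => ?_)
      simp only [mem_union, mem_filter, mem_univ, true_and, mem_insert, mem_singleton] at hy hy'
      rcases hy' with rfl | rfl
      · exact hy.elim G.irrefl fun h => hadj h.symm
      · exact hy.elim hadj G.irrefl
    rw [← h2] at h1
    have h3 := card_le_card (erase_subset s(u, v) E)
    omega

/-- If `d` deletions isolate `v`, they are all spent around `v`, and two further vertices that are
not adjacent afterwards keep at least two neighbours. -/
lemma two_le_card_liveNbrs_pair (hG : IsRobust G d) (hd : 3 ≤ d) (h : #X + #E ≤ d) {u₁ u₂ v : V}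
    (hv : liveNbrs G X E {v} = ∅) (hu : u₁ ≠ u₂) (h₁ : u₁ ≠ v) (h₂ : u₂ ≠ v)
    (h₁X : u₁ ∉ X) (h₂X : u₂ ∉ X) (hind : u₂ ∉ liveNbrs G X E {u₁}) :
    2 ≤ #(liveNbrs G X E {u₁, u₂}) := by
  have h0 := card_filter_adj_le_of_liveNbrs_eq_empty hv
  rw [hG.degree_eq] at h0
  have hXc := card_le_card (inter_subset_right : univ.filter (G.Adj v) ∩ X ⊆ X)
  have hEc := card_filter_le E (v ∈ ·)
  have hEv : ∀ e ∈ E, v ∈ e := filter_eq_self.1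
    (eq_of_subset_of_card_le (filter_subset (v ∈ ·) E) (by omega))
  have hXv : univ.filter (G.Adj v) ∩ X = X := eq_of_subset_of_card_le inter_subset_right (by omega)
  have hE : ∀ {z y}, z ≠ v → y ≠ v → s(z, y) ∉ E := fun hz hy he => by
    rcases Sym2.mem_iff.1 (hEv _ he) with h | h
    · exact hz h.symm
    · exact hy h.symm
  have hadj : ¬ G.Adj u₁ u₂ := fun h => hind (by simp [h₂X, h, hE h₁ h₂])
  have h3 := hG.add_two_le_card_union hd hu hadj
  have hsub : univ.filter (G.Adj u₁) ∪ univ.filter (G.Adj u₂) ⊆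
      insert v (X ∪ liveNbrs G X E {u₁, u₂}) := by
    intro y hy
    simp only [mem_union, mem_filter, mem_univ, true_and] at hy
    simp only [mem_insert, mem_union, mem_liveNbrs, mem_singleton, exists_eq_or_imp, exists_eq_left]
    by_cases hyv : y = v
    · exact Or.inl hyv
    by_cases hyX : y ∈ X
    · exact Or.inr (Or.inl hyX)
    refine Or.inr (Or.inr ⟨hyX, hy.imp (fun h => ⟨h, hE h₁ hyv⟩) fun h => ⟨h, hE h₂ hyv⟩⟩)
  by_cases hXd : #X < d
  · have h4 := (card_le_card hsub).trans (card_insert_le _ _)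
    have h5 := card_union_le X (liveNbrs G X E {u₁, u₂})
    omega
  · -- here `X` is the whole neighbourhood of `v`, so `v` is not adjacent to `u₁` or `u₂`
    have hX : univ.filter (G.Adj v) ⊆ X := by
      have : X = univ.filter (G.Adj v) := eq_of_subset_of_card_le
        (inter_eq_right.1 hXv) (by rw [hG.degree_eq]; omega)
      exact this.symm.subset
    have hvT : v ∉ univ.filter (G.Adj u₁) ∪ univ.filter (G.Adj u₂) := fun hvT => by
      simp only [mem_union, mem_filter, mem_univ, true_and] at hvT
      rcases hvT with h | h
      · exact h₁X (hX (by simpa using h.symm))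
      · exact h₂X (hX (by simpa using h.symm))
    have h4 := card_le_card ((subset_insert_iff_of_notMem hvT).1 hsub)
    have h5 := card_union_le X (liveNbrs G X E {u₁, u₂})
    omega

end IsRobust

end Robust

/-! ### Gluing two robust graphs -/

section Glue

open Classical Finset

variable {V V₁ V₂ : Type u} {G : SimpleGraph V} {G₁ : SimpleGraph V₁} {G₂ : SimpleGraph V₂}
  {ι₁ : V₁ ↪ V} {ι₂ : V₂ ↪ V} {M₁ M₂ : V₁ ≃ V₂}

/-- `G` consists of the images of `G₁` and `G₂` under `ι₁` and `ι₂`, joined by the edges of two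
disjoint perfect matchings. This is `glue` up to isomorphism, in a form symmetric in the two
parts. -/
structure IsGlued (G : SimpleGraph V) (G₁ : SimpleGraph V₁) (G₂ : SimpleGraph V₂) (ι₁ : V₁ ↪ V)
    (ι₂ : V₂ ↪ V) (M₁ M₂ : V₁ ≃ V₂) : Prop where
  adj_left : ∀ a b, G.Adj (ι₁ a) (ι₁ b) ↔ G₁.Adj a b
  adj_right : ∀ a b, G.Adj (ι₂ a) (ι₂ b) ↔ G₂.Adj a b
  adj_cross : ∀ a b, G.Adj (ι₁ a) (ι₂ b) ↔ b = M₁ a ∨ b = M₂ a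
  ne : ∀ a b, ι₁ a ≠ ι₂ b
  cover : ∀ x, (∃ a, ι₁ a = x) ∨ ∃ b, ι₂ b = x
  disj : ∀ a, M₁ a ≠ M₂ a

lemma isGlued_of_iso (e : G ≃g glue G₁ G₂ M₁ M₂) (disj : ∀ a, M₁ a ≠ M₂ a) :
    IsGlued G G₁ G₂ (Function.Embedding.inl.trans e.symm.toEquiv.toEmbedding)
      (Function.Embedding.inr.trans e.symm.toEquiv.toEmbedding) M₁ M₂ where
  adj_left a b := e.symm.map_rel_iff'
  adj_right a b := e.symm.map_rel_iff'
  adj_cross a b := e.symm.map_rel_iff'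
  ne a b h := Sum.inl_ne_inr (e.symm.injective h)
  cover x := by
    obtain ⟨y, rfl⟩ := e.symm.surjective x
    rcases y with a | b
    · exact Or.inl ⟨a, rfl⟩
    · exact Or.inr ⟨b, rfl⟩
  disj := disj

lemma IsGlued.symm (h : IsGlued G G₁ G₂ ι₁ ι₂ M₁ M₂) :
    IsGlued G G₂ G₁ ι₂ ι₁ M₁.symm M₂.symm where
  adj_left := h.adj_right
  adj_right := h.adj_left
  adj_cross a b := by
    rw [G.adj_comm, h.adj_cross, Equiv.eq_symm_apply, Equiv.eq_symm_apply, eq_comm,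
      eq_comm (a := a)]
  ne a b := (h.ne b a).symm
  cover x := (h.cover x).symm
  disj b hb := h.disj (M₁.symm b) (by rw [hb, Equiv.apply_symm_apply, ← hb, Equiv.apply_symm_apply])

variable [Fintype V₁]

/-- The vertices of a part that lie in `A`. -/
noncomputable def partVerts (ι : V₁ ↪ V) (A : Finset V) : Finset V₁ :=
  univ.filter fun a => ι a ∈ A

/-- The pairs of vertices of a part that lie in `E`. -/
noncomputable def partEdges (ι : V₁ ↪ V) (E : Finset (Sym2 V)) : Finset (Sym2 V₁) :=
  univ.filter fun e => e.map ι ∈ E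

/-- The edges of a matching between the two parts that lie in `E`, given by their left ends. -/
noncomputable def crossEdges (ι₁ : V₁ ↪ V) (ι₂ : V₂ ↪ V) (M : V₁ ≃ V₂) (E : Finset (Sym2 V)) :
    Finset V₁ :=
  univ.filter fun a => s(ι₁ a, ι₂ (M a)) ∈ E

@[simp]
lemma mem_partVerts {ι : V₁ ↪ V} {A : Finset V} {a : V₁} : a ∈ partVerts ι A ↔ ι a ∈ A := by
  simp [partVerts]

@[simp]
lemma mem_partEdges {ι : V₁ ↪ V} {E : Finset (Sym2 V)} {e : Sym2 V₁} :
    e ∈ partEdges ι E ↔ e.map ι ∈ E := by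
  simp [partEdges]

@[simp]
lemma mem_crossEdges {M : V₁ ≃ V₂} {E : Finset (Sym2 V)} {a : V₁} :
    a ∈ crossEdges ι₁ ι₂ M E ↔ s(ι₁ a, ι₂ (M a)) ∈ E := by
  simp [crossEdges]

lemma disjoint_partVerts {ι : V₁ ↪ V} {A B : Finset V} (h : Disjoint A B) :
    Disjoint (partVerts ι A) (partVerts ι B) :=
  disjoint_left.2 fun _ hA hB => disjoint_left.1 h (mem_partVerts.1 hA) (mem_partVerts.1 hB)

variable {X : Finset V} {E : Finset (Sym2 V)} {A : Finset V} {d : ℕ}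

/-- A matching sends each vertex of `A` in the first part to a neighbour of `A`, unless its image or
the matching edge is deleted. -/
lemma card_partVerts_le [Fintype V] [Fintype V₂] {M : V₁ ≃ V₂}
    (hM : ∀ a, G.Adj (ι₁ a) (ι₂ (M a))) :
    #(partVerts ι₁ A) ≤ #(partVerts ι₂ (liveNbrs G X E A)) + #(partVerts ι₂ X) +
      #(crossEdges ι₁ ι₂ M E) := by
  have hsub : (partVerts ι₁ A).map M.toEmbedding ⊆
      partVerts ι₂ (liveNbrs G X E A) ∪ partVerts ι₂ X ∪
        (crossEdges ι₁ ι₂ M E).map M.toEmbedding := by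
    intro b hb
    obtain ⟨a, ha, rfl⟩ := mem_map.1 hb
    by_cases hX : ι₂ (M a) ∈ X
    · simp [hX]
    by_cases hE : s(ι₁ a, ι₂ (M a)) ∈ E
    · simp [hE]
    refine mem_union_left _ (mem_union_left _ (mem_partVerts.2 (mem_liveNbrs.2 ?_)))
    exact ⟨hX, ι₁ a, mem_partVerts.1 ha, hM a, hE⟩
  have h1 := card_le_card hsub
  have h2 := card_union_le (partVerts ι₂ (liveNbrs G X E A) ∪ partVerts ι₂ X)
    ((crossEdges ι₁ ι₂ M E).map M.toEmbedding)
  have h3 := card_union_le (partVerts ι₂ (liveNbrs G X E A)) (partVerts ι₂ X)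
  rw [card_map] at h1 h2
  omega

namespace IsGlued

section

variable [Fintype V₂]

lemma card_partVerts_add (h : IsGlued G G₁ G₂ ι₁ ι₂ M₁ M₂) (A : Finset V) :
    #(partVerts ι₁ A) + #(partVerts ι₂ A) = #A := by
  rw [← card_map ι₁, ← card_map ι₂, ← card_union_of_disjoint]
  · congr 1
    ext x
    simp only [mem_union, mem_map, mem_partVerts]
    constructor
    · rintro (⟨a, ha, rfl⟩ | ⟨a, ha, rfl⟩) <;> exact ha
    · intro hx
      rcases h.cover x with ⟨a, rfl⟩ | ⟨a, rfl⟩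
      · exact Or.inl ⟨a, hx, rfl⟩
      · exact Or.inr ⟨a, hx, rfl⟩
  · rw [disjoint_left]
    intro x hx hx'
    obtain ⟨a, -, rfl⟩ := mem_map.1 hx
    obtain ⟨b, -, hb⟩ := mem_map.1 hx'
    exact h.ne a b hb.symm

lemma card_edges_le (h : IsGlued G G₁ G₂ ι₁ ι₂ M₁ M₂) (E : Finset (Sym2 V)) :
    #(partEdges ι₁ E) + #(partEdges ι₂ E) +
      (#(crossEdges ι₁ ι₂ M₁ E) + #(crossEdges ι₁ ι₂ M₂ E)) ≤ #E := by
  rw [← card_disjSum, ← card_disjSum, ← card_disjSum]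
  refine card_le_card_of_injOn (Sum.elim (Sum.elim (Sym2.map ι₁) (Sym2.map ι₂))
    (Sum.elim (fun a => s(ι₁ a, ι₂ (M₁ a))) fun a => s(ι₁ a, ι₂ (M₂ a)))) ?_
    (Function.Injective.injOn ?_)
  · rintro ((e | e) | (a | a)) he <;> simpa using he
  · have hne := h.ne
    have hne' := fun a b => (h.ne a b).symm
    rintro ((e | e) | (a | a)) ((f | f) | (b | b)) hef
    · simpa using Sym2.map.injective ι₁.injective hef
    · induction e; induction f; simp [hne] at hef
    · induction e; simp [hne] at hef
    · induction e; simp [hne] at hef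
    · induction e; induction f; simp [hne'] at hef
    · simpa using Sym2.map.injective ι₂.injective hef
    · induction e; simp [hne'] at hef
    · induction e; simp [hne'] at hef
    · induction f; simp [hne'] at hef
    · induction f; simp [hne] at hef
    · simpa [hne] using hef
    · simp only [Sum.elim_inr, Sum.elim_inl, Sym2.eq_iff, hne, false_and, or_false,
        EmbeddingLike.apply_eq_iff_eq] at hef
      obtain ⟨rfl, hef⟩ := hef
      exact absurd hef (h.disj a)
    · induction f; simp [hne'] at hef
    · induction f; simp [hne] at hef
    · simp only [Sum.elim_inr, Sum.elim_inl, Sym2.eq_iff, hne, false_and, or_false,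
        EmbeddingLike.apply_eq_iff_eq] at hef
      obtain ⟨rfl, hef⟩ := hef
      exact absurd hef.symm (h.disj a)
    · simpa [hne] using hef

end

lemma liveNbrs_partVerts_subset [Fintype V] (h : IsGlued G G₁ G₂ ι₁ ι₂ M₁ M₂) :
    liveNbrs G₁ (partVerts ι₁ X) (partEdges ι₁ E) (partVerts ι₁ A) ⊆
      partVerts ι₁ (liveNbrs G X E A) := by
  intro y hy
  simp only [mem_liveNbrs, mem_partVerts, mem_partEdges, Sym2.map_mk] at hy ⊢
  obtain ⟨hyX, x, hx, hxy, hE⟩ := hy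
  exact ⟨hyX, ι₁ x, hx, (h.adj_left x y).2 hxy, hE⟩

variable [Fintype V] [Fintype V₂]

/-- The case of `IsGlued.isRobust` in which at least `d` deletions fall into the first part. -/
lemma card_le_card_liveNbrs_of_le (h : IsGlued G G₁ G₂ ι₁ ι₂ M₁ M₂) (h₁ : IsRobust G₁ d)
    (h₂ : IsRobust G₂ d) (hd : 7 ≤ d) (hXE : #X + #E ≤ d + 2)
    (hiso : ∀ v ∉ X, (liveNbrs G X E {v}).Nonempty) (hA : Disjoint A X)
    (hind : Disjoint A (liveNbrs G X E A))
    (hle : d ≤ #(partVerts ι₁ X) + #(partEdges ι₁ E)) :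
    #A ≤ #(liveNbrs G X E A) := by
  by_contra! hlt
  have hXc := h.card_partVerts_add X
  have hEc := h.card_edges_le E
  have hAc := h.card_partVerts_add A
  have hNc := h.card_partVerts_add (liveNbrs G X E A)
  obtain ⟨t, ht⟩ := Nat.exists_eq_add_of_le hle
  have hN₁ := card_le_card (h.liveNbrs_partVerts_subset (X := X) (E := E) (A := A))
  have hN₂ := h.symm.liveNbrs_partVerts_subset (X := X) (E := E) (A := A)
  -- the surplus of the second part outweighs the deficiency of the first
  have hA₂ : partVerts ι₂ A = ∅ := by
    by_contra hne
    have hdef := h₁.card_le_add (by omega) (t + 1) (X := partVerts ι₁ X) (E := partEdges ι₁ E)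
      (by omega) (disjoint_partVerts hA)
    have hsur := h₂.card_add_le_card_liveNbrs (X := partVerts ι₂ X) (E := partEdges ι₂ E)
      (by omega) (disjoint_partVerts hA) ((disjoint_partVerts hind).mono_right hN₂)
      (nonempty_iff_ne_empty.2 hne)
    have := card_le_card hN₂
    omega
  rw [hA₂, card_empty, add_zero] at hAc
  have hmem : ∀ x ∈ A, ∃ a ∈ partVerts ι₁ A, ι₁ a = x := by
    intro x hx
    rcases h.cover x with ⟨a, rfl⟩ | ⟨b, rfl⟩
    · exact ⟨a, mem_partVerts.2 hx, rfl⟩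
    · have : b ∈ partVerts ι₂ A := mem_partVerts.2 hx
      simp [hA₂] at this
  have hc₁ := card_partVerts_le (X := X) (E := E) (A := A) (M := M₁)
    fun a => (h.adj_cross _ _).2 (Or.inl rfl)
  have hc₂ := card_partVerts_le (X := X) (E := E) (A := A) (M := M₂)
    fun a => (h.adj_cross _ _).2 (Or.inr rfl)
  have hnotX : ∀ a ∈ partVerts ι₁ A, a ∉ partVerts ι₁ X := fun a ha =>
    disjoint_left.1 (disjoint_partVerts hA) ha
  -- a vertex isolated in the first part has a neighbour in the second
  have hcross : ∀ a ∈ partVerts ι₁ A,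
      liveNbrs G₁ (partVerts ι₁ X) (partEdges ι₁ E) {a} = ∅ →
      (partVerts ι₂ (liveNbrs G X E A)).Nonempty := by
    intro a ha hae
    obtain ⟨y, hy⟩ := hiso (ι₁ a) fun hX => hnotX a ha (mem_partVerts.2 hX)
    rcases h.cover y with ⟨b, rfl⟩ | ⟨b, rfl⟩
    · have : b ∈ liveNbrs G₁ (partVerts ι₁ X) (partEdges ι₁ E) {a} := by
        simpa [h.adj_left] using hy
      simp [hae] at this
    · exact ⟨b, mem_partVerts.2
        (liveNbrs_mono (singleton_subset_iff.2 (mem_partVerts.1 ha)) hy)⟩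
  by_cases hN0 : #(partVerts ι₁ (liveNbrs G X E A)) = 0
  · have hempty : ∀ a ∈ partVerts ι₁ A,
        liveNbrs G₁ (partVerts ι₁ X) (partEdges ι₁ E) {a} = ∅ := by
      intro a ha
      rw [← card_eq_zero]
      have := card_le_card (liveNbrs_mono (G := G₁) (X := partVerts ι₁ X)
        (E := partEdges ι₁ E) (singleton_subset_iff.2 ha))
      omega
    have hone : #(partVerts ι₁ A) ≤ 1 := card_le_one.2 fun a ha b hb =>
      h₁.eq_of_liveNbrs_eq_empty (by omega) (by omega) (hempty a ha) (hempty b hb)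
        (hnotX a ha) (hnotX b hb)
    obtain ⟨a, ha⟩ : (partVerts ι₁ A).Nonempty := by
      rw [← card_pos]; omega
    have := (hcross a ha (hempty a ha)).card_pos
    omega
  · have hone : #(partVerts ι₁ (liveNbrs G X E A)) = 1 := by omega
    have hnot : ¬ ∀ w ∉ partVerts ι₁ X,
        (liveNbrs G₁ (partVerts ι₁ X) (partEdges ι₁ E) {w}).Nonempty := fun hw => by
      have := h₁.card_le _ _ (by omega) hw _ (disjoint_partVerts hA)
      omega
    push Not at hnot
    obtain ⟨v, hvX, hv⟩ := hnot
    have htwo : 1 < #((partVerts ι₁ A).erase v) := by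
      by_cases hvA : v ∈ partVerts ι₁ A
      · have h3 := (hcross v hvA hv).card_pos
        have h4 := card_erase_add_one hvA
        omega
      · rw [erase_eq_of_notMem hvA]
        omega
    obtain ⟨u₁, hu₁, u₂, hu₂, hu⟩ := one_lt_card.1 htwo
    rw [mem_erase] at hu₁ hu₂
    have hpair := h₁.two_le_card_liveNbrs_pair (by omega) (by omega) hv hu hu₁.1 hu₂.1
      (hnotX _ hu₁.2) (hnotX _ hu₂.2) fun hmem => by
        have h3 := h.liveNbrs_partVerts_subset
          (liveNbrs_mono (singleton_subset_iff.2 hu₁.2) hmem)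
        exact disjoint_left.1 (disjoint_partVerts hind) hu₂.2 h3
    have hsub : ({u₁, u₂} : Finset V₁) ⊆ partVerts ι₁ A :=
      insert_subset hu₁.2 (singleton_subset_iff.2 hu₂.2)
    have := card_le_card (liveNbrs_mono (G := G₁) (X := partVerts ι₁ X)
      (E := partEdges ι₁ E) hsub)
    omega

lemma card_filter_adj (h : IsGlued G G₁ G₂ ι₁ ι₂ M₁ M₂) (a : V₁) :
    #(univ.filter (G.Adj (ι₁ a))) = #(univ.filter (G₁.Adj a)) + 2 := by
  rw [← h.card_partVerts_add]
  congr 1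
  · congr 1
    ext b
    simp [h.adj_left]
  · rw [← card_pair (h.disj a)]
    congr 1
    ext b
    simp [h.adj_cross]

/-- Joining two robust graphs of degree `d` by two disjoint perfect matchings gives a robust graph
of degree `d + 2`. -/
theorem isRobust (h : IsGlued G G₁ G₂ ι₁ ι₂ M₁ M₂) (h₁ : IsRobust G₁ d) (h₂ : IsRobust G₂ d)
    (hd : 7 ≤ d) : IsRobust G (d + 2) where
  degree_eq v := by
    rcases h.cover v with ⟨a, rfl⟩ | ⟨b, rfl⟩
    · rw [h.card_filter_adj, h₁.degree_eq]
    · rw [h.symm.card_filter_adj, h₂.degree_eq]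
  card_le X E hXE hiso A hA := by
    by_contra! hlt
    obtain ⟨I, hI, hind, hIlt⟩ := exists_independent_of_card_liveNbrs_lt hA hlt
    refine hIlt.not_ge ?_
    by_cases hle₁ : d ≤ #(partVerts ι₁ X) + #(partEdges ι₁ E)
    · exact h.card_le_card_liveNbrs_of_le h₁ h₂ hd hXE hiso hI hind hle₁
    by_cases hle₂ : d ≤ #(partVerts ι₂ X) + #(partEdges ι₂ E)
    · exact h.symm.card_le_card_liveNbrs_of_le h₂ h₁ hd hXE hiso hI hind hle₂
    rw [← h.card_partVerts_add, ← h.card_partVerts_add (liveNbrs G X E I)]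
    exact Nat.add_le_add
      ((h₁.card_le_of_lt (by omega) (disjoint_partVerts hI)).trans
        (card_le_card h.liveNbrs_partVerts_subset))
      ((h₂.card_le_of_lt (by omega) (disjoint_partVerts hI)).trans
        (card_le_card h.symm.liveNbrs_partVerts_subset))

end IsGlued

end Glue

/-! ### Robustness and fractional strong super matching -/

section SuperMatched

open Classical Finset

variable {V : Type u} [Fintype V] {G : SimpleGraph V} {d : ℕ}

lemma minDegree_eq [Nonempty V] (h : ∀ v, #(univ.filter (G.Adj v)) = d) : G.minDegree = d := by
  have : ∀ v, G.degree v = d := fun v => by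
    rw [← h v, ← SimpleGraph.card_neighborFinset_eq_degree]
    congr 1
    ext w
    simp
  obtain ⟨v, hv⟩ := G.exists_minimal_degree_vertex
  rw [hv, this]

lemma fsmp_le {F : FaultSet G} (h : IsFSMPSet F) : fsmp G ≤ F.card :=
  iInf₂_le F h

theorem isRobust_of_fractionalStronglySuperMatched [Nonempty V]
    (hdeg : ∀ v, #(univ.filter (G.Adj v)) = d) (h : FractionalStronglySuperMatched G) :
    IsRobust G d where
  degree_eq := hdeg
  card_le X E hXE hiso A hA := by
    have hfsmp : fsmp G = d := by
      rw [h.1, minDegree_eq hdeg]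
    set F : FaultSet G := ⟨X, E.filter (· ∈ G.edgeSet), fun e he => (mem_filter.1 he).2⟩ with hF
    have hlive : ∀ B, liveNbrs G F.verts F.edges B = liveNbrs G X E B := by
      intro B
      ext y
      simp only [mem_liveNbrs, hF, mem_filter, SimpleGraph.mem_edgeSet]
      exact and_congr_right fun _ => exists_congr fun x => by tauto
    have hFd : F.card ≤ d := (Nat.add_le_add_left (card_filter_le _ _) _).trans hXE
    have hfpm : HasFractionalPerfectMatching F.delete := by
      by_contra hno
      have hcard : (F.card : ℕ∞) = fsmp G :=
        le_antisymm (by rw [hfsmp]; exact_mod_cast hFd) (fsmp_le (by convert hno))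
      obtain ⟨v, hv, hve⟩ := F.hasIsolatedVertex_delete_iff.1 (h.2 F ⟨by convert hno, hcard⟩)
      rw [hlive] at hve
      exact (hiso v hv).ne_empty hve
    rw [← hlive]
    exact F.hasFractionalPerfectMatching_delete_iff.1 hfpm A hA

theorem IsRobust.fractionalStronglySuperMatched [Nonempty V] (h : IsRobust G d) :
    FractionalStronglySuperMatched G := by
  have hiso : ∀ F : FaultSet G, IsFSMPSet F → F.card ≤ d → HasIsolatedVertex F.delete := by
    intro F hF hle
    rw [F.hasIsolatedVertex_delete_iff]
    by_contra! hne
    refine hF ?_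
    convert F.hasFractionalPerfectMatching_delete_iff.2 (h.card_le _ _ hle hne)
  have hge : (d : ℕ∞) ≤ fsmp G := le_iInf₂ fun F hF => by
    by_contra! hlt
    replace hlt : F.card < d := by exact_mod_cast hlt
    obtain ⟨v, -, hv⟩ := F.hasIsolatedVertex_delete_iff.1 (hiso F hF hlt.le)
    exact (h.nonempty_liveNbrs hlt v).ne_empty hv
  have hle : fsmp G ≤ d := by
    obtain ⟨v⟩ := ‹Nonempty V›
    -- delete all edges at a vertex
    set F : FaultSet G := ⟨∅, (univ.filter (G.Adj v)).image fun w => s(v, w), by simp⟩ with hF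
    have hFc : F.card = d := by
      rw [FaultSet.card, hF, card_empty, zero_add,
        card_image_of_injective _ fun x y hxy => Sym2.congr_right.1 hxy, h.degree_eq]
    have hFS : IsFSMPSet F := fun hfpm => by
      have h1 := F.hasFractionalPerfectMatching_delete_iff.1 (by convert hfpm) {v} (by simp [hF])
      have h2 : liveNbrs G F.verts F.edges {v} = ∅ := by
        ext y
        simp +contextual [hF]
      simp [h2] at h1
    exact (fsmp_le hFS).trans_eq (by rw [hFc])
  have heq := le_antisymm hle hge
  refine ⟨?_, fun F hF => hiso F hF.1 ?_⟩
  · rw [FractionalStronglyMaximallyMatched, heq, minDegree_eq h.degree_eq]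
  · have := hF.2
    rw [heq] at this
    exact (Nat.cast_inj.1 this).le

end SuperMatched

/-! ### Regularity of generalized augmented cubes -/

section Cube

open Finset

/-- Decidability of adjacency in the augmented cube, by recursion on the dimension. It makes the
degree in dimension `4` computable. -/
@[reducible]
def decidableAdjAugmentedCube : (n : ℕ) → (u v : Fin n → Bool) →
    Decidable ((augmentedCube n).Adj u v)
  | 0, _, _ => isFalse id
  | 1, u, v => inferInstanceAs (Decidable (u ≠ v))
  | n + 2, u, v =>
    have := decidableAdjAugmentedCube (n + 1) (Fin.tail u) (Fin.tail v)
    inferInstanceAs (Decidable ((u 0 = v 0 ∧ (augmentedCube (n + 1)).Adj (Fin.tail u) (Fin.tail v)) ∨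
        (u 0 ≠ v 0 ∧ ((∀ i, Fin.tail u i = Fin.tail v i) ∨ (∀ i, Fin.tail u i ≠ Fin.tail v i)))))

attribute [local instance] decidableAdjAugmentedCube

lemma card_filter_adj_augmentedCube_four :
    ∀ v, #(univ.filter ((augmentedCube 4).Adj v)) = 7 := by
  set_option maxRecDepth 100000 in
  decide

end Cube

section Regular

open Classical Finset

/-- An `n`-dimensional generalized augmented cube is finite, nonempty and `(2n - 1)`-regular. -/
theorem IsGAQ.regular {n : ℕ} {V : Type u} {G : SimpleGraph V} (h : IsGAQ n G) :
    4 ≤ n ∧ Finite V ∧ Nonempty V ∧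
      ∀ [Fintype V] (v : V), #(univ.filter (G.Adj v)) = 2 * n - 1 := by
  induction h with
  | @base V G e =>
    refine ⟨le_rfl, Finite.of_equiv _ e.symm.toEquiv, ⟨e.symm fun _ => false⟩, fun v => ?_⟩
    have h7 := card_filter_adj_augmentedCube_four (e v)
    rw [← card_map e.toEquiv.toEmbedding]
    convert h7 using 2
    ext w
    simp only [mem_map, mem_filter, mem_univ, true_and]
    constructor
    · rintro ⟨x, hx, rfl⟩
      exact e.map_rel_iff'.2 hx
    · intro hw
      refine ⟨e.symm w, ?_, by simp⟩
      rw [← e.map_rel_iff']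
      simpa using hw
  | @step n V₁ V₂ V G₁ G₂ _ _ M₁ M₂ disj G e ih₁ ih₂ =>
    obtain ⟨hn, hf₁, hne, hd₁⟩ := ih₁
    obtain ⟨-, hf₂, -, hd₂⟩ := ih₂
    obtain ⟨v₀⟩ := hne
    have := Fintype.ofFinite V₁
    have := Fintype.ofFinite V₂
    have h := isGlued_of_iso e disj
    refine ⟨by omega, Finite.of_equiv _ e.symm.toEquiv, ⟨e.symm (Sum.inl v₀)⟩, fun v => ?_⟩
    rcases h.cover v with ⟨a, rfl⟩ | ⟨b, rfl⟩
    · rw [h.card_filter_adj, hd₁]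
      omega
    · rw [h.symm.card_filter_adj, hd₂]
      omega

end Regular

end FSMP

theorem theorem3p5 (n : ℕ) (hn : 5 ≤ n)
    (h₁ : ∀ (V : Type u) [Fintype V] (G : SimpleGraph V),
      FSMP.IsGAQ (n - 1) G → FSMP.EvenStronglySuperMatched G)
    (h₂ : ∀ (V : Type u) [Fintype V] (G : SimpleGraph V),
      FSMP.IsGAQ (n - 1) G → FSMP.FractionalStronglySuperMatched G) :
    ∀ (V : Type u) [Fintype V] (G : SimpleGraph V),
      FSMP.IsGAQ n G → FSMP.FractionalStronglySuperMatched G := by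
  intro V _ G hG
  have hne : Nonempty V := hG.regular.2.2.1
  cases hG with
  | base e => omega
  | @step m V₁ V₂ _ G₁ G₂ hG₁ hG₂ M₁ M₂ disj _ e =>
    obtain ⟨hm, _, _, hdeg₁⟩ := hG₁.regular
    obtain ⟨-, _, _, hdeg₂⟩ := hG₂.regular
    have := Fintype.ofFinite V₁
    have := Fintype.ofFinite V₂
    have hR₁ := FSMP.isRobust_of_fractionalStronglySuperMatched hdeg₁ (h₂ V₁ G₁ hG₁)
    have hR₂ := FSMP.isRobust_of_fractionalStronglySuperMatched hdeg₂ (h₂ V₂ G₂ hG₂)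
    exact ((FSMP.isGlued_of_iso e disj).isRobust hR₁ hR₂
      (by omega)).fractionalStronglySuperMatched
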